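/- Let $n\ge 0$ and let $P\subset\mathbb R^n$ be a lattice polytope (the convex hull of finitely many points of $\mathbb Z^n$) of dimension $n$. Let $\mathrm{cd}(P)$ be its codegree, the least integer $t>0$ such that the interior of $tP$ contains a point of $\mathbb Z^n$. Assume that $P$ is Gorenstein, i.e. that the canonical divisor $K_{X_P}$ of the normal toric variety $X_P$ defined by the inner normal fan of $P$ is Cartier; equivalently, for every vertex $v$ of $P$ there is $m_v\in\mathbb Z^n$ such that $\langle u,m_v\rangle=1$ for the primitive inner normal vector $u\in\mathbb Z^n$ of every facet of $P$ containing $v$. Then $\mathrm{cd}(P)=n+1$ if and only if $P$ is the unimodular simplex $\Delta_n$, that is, $P=A\Delta_n+b$ for some $A\in \mathrm{GL}_n(\mathbb Z)$ and $b\in\mathbb Z^n$, where $\Delta_n=\mathrm{conv}(0,e_1,\dots,e_n)$. -/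

import Mathlib

open scoped Pointwise

namespace LatticePolytope

/-- The inclusion of the lattice `ℤⁿ` in `ℝⁿ`. -/
def latticePoint {n : ℕ} (m : Fin n → ℤ) : Fin n → ℝ := fun i => (m i : ℝ)

/-- A lattice polytope in `ℝⁿ`: the convex hull of finitely many points of `ℤⁿ`. -/
def IsLatticePolytope {n : ℕ} (P : Set (Fin n → ℝ)) : Prop :=
  ∃ S : Set (Fin n → ℤ), S.Finite ∧ P = convexHull ℝ (latticePoint '' S)

/-- The codegree `cd(P)`: the least positive integer `t` such that the interior of the dilate `tP`
contains a lattice point. (For a full-dimensional lattice polytope such a `t` exists. Were there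
none, the value would be `0`, so a positive value is always a true minimum.) -/
noncomputable def codegree {n : ℕ} (P : Set (Fin n → ℝ)) : ℕ :=
  sInf {t : ℕ | 0 < t ∧ ∃ m : Fin n → ℤ, latticePoint m ∈ interior ((t : ℝ) • P)}

/-- The cone of the (inner) normal fan of `P` attached to a point `v` of `P`: the covectors whose
minimum on `P` is attained at `v`. For a full-dimensional polytope the maximal cones of the normal
fan are these cones for `v` a vertex. -/
def normalCone {n : ℕ} (P : Set (Fin n → ℝ)) (v : Fin n → ℝ) : Set (Fin n → ℝ) :=
  {u | ∀ x ∈ P, u ⬝ᵥ v ≤ u ⬝ᵥ x}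

/-- The face of `P` on which the covector `u` attains its minimum. -/
def face {n : ℕ} (P : Set (Fin n → ℝ)) (u : Fin n → ℝ) : Set (Fin n → ℝ) :=
  {v ∈ P | ∀ x ∈ P, u ⬝ᵥ v ≤ u ⬝ᵥ x}

/-- `u` is the primitive generator of a ray of the normal fan of a full-dimensional polytope
`P ⊆ ℝⁿ`, i.e. the primitive inner normal vector of a facet: its coordinates are coprime and the
face it cuts out has dimension `n - 1`. -/
def IsPrimitiveFacetNormal {n : ℕ} (P : Set (Fin n → ℝ)) (u : Fin n → ℤ) : Prop :=
  Finset.univ.gcd u = 1 ∧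
    Module.finrank ℝ (vectorSpan ℝ (face P (latticePoint u))) + 1 = n

/-- `P` (full-dimensional) is Gorenstein, i.e. the canonical divisor `K = -∑ D_u` of the normal
toric variety `X_P` of its normal fan is Cartier: on every maximal cone, the linear function
defining the invariant divisor `-K` is given by a lattice vector. So for every vertex `v` of `P`
there is `m ∈ ℤⁿ` with `⟨u, m⟩ = 1` for all primitive generators `u` of the rays of the
cone of `v`. -/
def IsGorenstein {n : ℕ} (P : Set (Fin n → ℝ)) : Prop :=
  ∀ v ∈ P.extremePoints ℝ, ∃ m : Fin n → ℤ, ∀ u : Fin n → ℤ,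
    IsPrimitiveFacetNormal P u → latticePoint u ∈ normalCone P v → u ⬝ᵥ m = 1

/-- The standard unimodular simplex `Δ_n = conv(0, e₁, …, e_n)` in `ℝⁿ`. -/
def unimodularSimplex (n : ℕ) : Set (Fin n → ℝ) :=
  convexHull ℝ (insert 0 (Set.range fun i : Fin n => Pi.single i (1 : ℝ)))

/-- Isomorphism of polytopes in `ℝⁿ` with respect to the lattice `ℤⁿ`: `P` is the image of `Q` under
an affine automorphism `x ↦ A x + b` of the lattice, with `A ∈ GL_n(ℤ)` and `b ∈ ℤⁿ`. -/
def UnimodularlyEquivalent {n : ℕ} (P Q : Set (Fin n → ℝ)) : Prop :=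
  ∃ (A : Matrix (Fin n) (Fin n) ℤ) (b : Fin n → ℤ), IsUnit A.det ∧
    P = (fun x => (A.map (Int.cast : ℤ → ℝ)).mulVec x + latticePoint b) '' Q

end LatticePolytope

open scoped Pointwise

namespace LatticePolytope

/-! Among the lattice points spanning `P`, choose an affine basis; its simplex lies in `P`. Codegree
`n + 1` forbids lattice points in the interior of `tP` for `0 < t ≤ n`, and this is used twice. If
some `w` in `P` lay outside the simplex, the basis points with nonnegative coordinate at `w`,
between 1 and `n` in number, would sum to a forbidden point (`eq_convexHull_of_codegree`). So `P` is
the simplex. If a lattice point had a nonintegral barycentric coordinate, weighting the basis points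
by one minus the fractional parts would give another (`fract_coord_eq_zero`). So the edges at a
vertex form a basis of `ℤⁿ`. Conversely, the codegree is invariant under lattice automorphisms, and
for the standard simplex it can be read off from the inequalities. -/

lemma latticePoint_sum {n : ℕ} {ι : Type*} (s : Finset ι) (f : ι → Fin n → ℤ) :
    latticePoint (∑ i ∈ s, f i) = ∑ i ∈ s, latticePoint (f i) := by
  ext j
  simp [latticePoint, Finset.sum_apply]

lemma latticePoint_add {n : ℕ} (a b : Fin n → ℤ) :
    latticePoint (a + b) = latticePoint a + latticePoint b := by
  ext j
  simp [latticePoint]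

lemma latticePoint_sub {n : ℕ} (a b : Fin n → ℤ) :
    latticePoint (a - b) = latticePoint a - latticePoint b := by
  ext j
  simp [latticePoint]

lemma latticePoint_zsmul {n : ℕ} (k : ℤ) (a : Fin n → ℤ) :
    latticePoint (k • a) = (k : ℝ) • latticePoint a := by
  ext j
  simp [latticePoint]

lemma latticePoint_mulVec {n : ℕ} (A : Matrix (Fin n) (Fin n) ℤ) (a : Fin n → ℤ) :
    latticePoint (A.mulVec a) = (A.map (Int.cast : ℤ → ℝ)).mulVec (latticePoint a) := by
  ext j
  simp [latticePoint, Matrix.mulVec, dotProduct]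

lemma latticePoint_injective {n : ℕ} :
    Function.Injective (latticePoint : (Fin n → ℤ) → Fin n → ℝ) := by
  intro a b h
  ext j
  have := congrFun h j
  simpa [latticePoint] using this

/-! ### Forbidden lattice points from barycentric coordinates -/

/-- Below the codegree, interiors of dilates contain no lattice points. -/
lemma notMem_interior_of_lt_codegree {n : ℕ} {P : Set (Fin n → ℝ)} {t : ℕ} (ht : 0 < t)
    (h : t < codegree P) (m : Fin n → ℤ) : latticePoint m ∉ interior ((t : ℝ) • P) :=
  fun hm => Nat.notMem_of_lt_sInf h ⟨ht, m, hm⟩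

lemma coord_sum_smul {ι E : Type*} [Fintype ι] [AddCommGroup E] [Module ℝ E]
    (b : AffineBasis ι ℝ E) {w : ι → ℝ} (hw : ∑ i, w i = 1) (i : ι) :
    b.coord i (∑ j, w j • b j) = w i := by
  rw [← Finset.affineCombination_eq_linear_combination _ _ _ hw]
  exact b.coord_apply_combination_of_mem (Finset.mem_univ i) hw

/-- A combination of an affine basis with positive weights of sum `t` is interior to the
`t`-th dilate of the simplex, hence of any set containing it. -/
lemma sum_smul_mem_interior {n : ℕ} {ι : Type*} [Fintype ι]
    (b : AffineBasis ι ℝ (Fin n → ℝ)) {P : Set (Fin n → ℝ)}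
    (hP : convexHull ℝ (Set.range b) ⊆ P) {w : ι → ℝ} {t : ℝ} (ht : 0 < t)
    (hw : ∑ i, w i = t) (hpos : ∀ i, 0 < w i) :
    ∑ i, w i • b i ∈ interior (t • P) := by
  rw [interior_smul₀ ht.ne']
  refine ⟨∑ i, (t⁻¹ * w i) • b i, interior_mono hP ?_, ?_⟩
  · rw [b.interior_convexHull]
    intro i
    rw [coord_sum_smul b (by rw [← Finset.mul_sum, hw, inv_mul_cancel₀ ht.ne'])]
    have := hpos i
    positivity
  · simp only [mul_smul, ← Finset.smul_sum]
    rw [smul_inv_smul₀ ht.ne']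

/-- If a convex set contains a simplex and a point outside it, the sum of the vertices with
nonnegative barycentric coordinate at that point is interior to the corresponding dilate. -/
lemma sum_nonneg_coord_mem_interior {n : ℕ} {ι : Type*} [Fintype ι]
    (b : AffineBasis ι ℝ (Fin n → ℝ)) {P : Set (Fin n → ℝ)} (hconv : Convex ℝ P)
    (hP : convexHull ℝ (Set.range b) ⊆ P) {w : Fin n → ℝ} (hw : w ∈ P)
    (J : Finset ι) (hJ : ∀ i, i ∈ J ↔ 0 ≤ b.coord i w) (hcard : 0 < J.card) :
    ∑ i ∈ J, b i ∈ interior ((J.card : ℝ) • P) := by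
  classical
  set k : ℝ := (J.card : ℝ) with hk
  have hk0 : 0 < k := by rw [hk]; exact_mod_cast hcard
  have hS : 0 ≤ ∑ j, |b.coord j w| := Finset.sum_nonneg fun _ _ => abs_nonneg _
  -- The barycentre of the `b i`, `i ∈ J`, minus `ε • w` must have only positive weights. The sum in
  -- `D` secures this on `J`, where `ε * k * b.coord i w < 1`; off `J` it holds as the coordinate of
  -- `w` is negative. The 2 gives `ε < 1`.
  set D : ℝ := 2 + k * ∑ j, |b.coord j w| with hD
  have hD2 : 2 ≤ D := by rw [hD]; nlinarith [mul_nonneg hk0.le hS]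
  have hD0 : 0 < D := by linarith
  set ε : ℝ := D⁻¹ with hε
  have hε0 : 0 < ε := inv_pos.mpr hD0
  have hεD : ε * D = 1 := inv_mul_cancel₀ hD0.ne'
  have hε1 : 0 < 1 - ε := by nlinarith
  set x : ι → ℝ := fun i => if i ∈ J then k⁻¹ else 0 with hx
  have hxsum : ∑ i, x i = 1 := by
    simp [hx, Finset.sum_ite_mem, ← hk, mul_inv_cancel₀ hk0.ne']
  have hwsum : ∑ i, b.coord i w = 1 := b.sum_coord_apply_eq_one w
  have hpos : ∀ i, 0 < x i - ε * b.coord i w := by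
    intro i
    by_cases hi : i ∈ J
    · have h1 : b.coord i w ≤ ∑ j, |b.coord j w| :=
        (le_abs_self _).trans
          (Finset.single_le_sum (fun j _ => abs_nonneg (b.coord j w)) (Finset.mem_univ i))
      have h2 : ε * (k * b.coord i w) < 1 := by
        rw [← hεD]
        refine mul_lt_mul_of_pos_left ?_ hε0
        have := mul_le_mul_of_nonneg_left h1 hk0.le
        rw [hD]
        linarith
      have h3 : x i = k⁻¹ := by simp [hx, hi]
      rw [h3, sub_pos, inv_eq_one_div, lt_div_iff₀ hk0]
      linarith
    · have h1 : b.coord i w < 0 := lt_of_not_ge fun h => hi ((hJ i).2 h)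
      have h3 : x i = 0 := by simp [hx, hi]
      rw [h3]
      nlinarith
  have hy := sum_smul_mem_interior b hP hε1
    (by rw [Finset.sum_sub_distrib, hxsum, ← Finset.mul_sum, hwsum, mul_one]) hpos
  rw [interior_smul₀ hε1.ne'] at hy
  obtain ⟨y, hyP, hye⟩ := hy
  -- Adding `ε • w` back exhibits the barycentre as a convex combination of an interior point and a
  -- point of `P`.
  have hz := hconv.combo_interior_self_mem_interior hyP hw hε1 hε0.le (by ring)
  rw [interior_smul₀ hk0.ne']
  refine ⟨_, hz, ?_⟩
  have hwe : ∑ i, b.coord i w • b i = w := b.linear_combination_coord_eq_self w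
  simp only at hye ⊢
  rw [hye]
  conv_lhs => enter [2, 2, 2]; rw [← hwe]
  simp only [sub_smul, mul_smul, Finset.sum_sub_distrib, ← Finset.smul_sum, sub_add_cancel]
  simp [hx, Finset.sum_ite_mem, ite_smul, ← Finset.smul_sum, smul_inv_smul₀ hk0.ne']

/-- A lattice polytope of codegree `n + 1` is the simplex on any affine basis it contains. -/
lemma eq_convexHull_of_codegree {n : ℕ} {P : Set (Fin n → ℝ)} (hconv : Convex ℝ P)
    (hcd : codegree P = n + 1) (b : AffineBasis (Fin (n + 1)) ℝ (Fin n → ℝ))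
    (v : Fin (n + 1) → Fin n → ℤ) (hv : ∀ i, b i = latticePoint (v i))
    (hP : convexHull ℝ (Set.range b) ⊆ P) : P = convexHull ℝ (Set.range b) := by
  classical
  refine Set.Subset.antisymm (fun w hw => ?_) hP
  by_contra hnot
  rw [b.convexHull_eq_nonneg_coord] at hnot
  simp only [Set.mem_ofPred_eq, not_forall, not_le] at hnot
  obtain ⟨i, hi⟩ := hnot
  set J : Finset (Fin (n + 1)) := Finset.univ.filter fun i => 0 ≤ b.coord i w with hJdef
  have hJ : ∀ i, i ∈ J ↔ 0 ≤ b.coord i w := by simp [hJdef]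
  have hpos : 0 < J.card := by
    rw [Finset.card_pos]
    by_contra hne
    rw [Finset.not_nonempty_iff_eq_empty] at hne
    have h1 : ∑ i, b.coord i w ≤ 0 := Finset.sum_nonpos fun j _ => by
      have : j ∉ J := by simp [hne]
      rw [hJ] at this
      exact (not_le.mp this).le
    rw [b.sum_coord_apply_eq_one w] at h1
    linarith
  have hlt : J.card < n + 1 := by
    have : J ⊂ Finset.univ := Finset.ssubset_univ_iff.2 fun h => by
      have : i ∈ J := by simp [h]
      rw [hJ] at this
      linarith
    simpa using Finset.card_lt_card this
  refine notMem_interior_of_lt_codegree hpos (by rwa [hcd]) (∑ i ∈ J, v i) ?_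
  rw [latticePoint_sum]
  simp only [← hv]
  exact sum_nonneg_coord_mem_interior b hconv hP hw J hJ hpos

/-- In a lattice simplex of codegree `n + 1`, lattice points have integral barycentric
coordinates. -/
lemma fract_coord_eq_zero {n : ℕ} {P : Set (Fin n → ℝ)}
    (hcd : codegree P = n + 1) (b : AffineBasis (Fin (n + 1)) ℝ (Fin n → ℝ))
    (v : Fin (n + 1) → Fin n → ℤ) (hv : ∀ i, b i = latticePoint (v i))
    (hP : convexHull ℝ (Set.range b) ⊆ P) (m : Fin n → ℤ) (i : Fin (n + 1)) :
    Int.fract (b.coord i (latticePoint m)) = 0 := by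
  by_contra hi
  set c : Fin (n + 1) → ℝ := fun i => b.coord i (latticePoint m) with hc
  have hcsum : ∑ i, c i = 1 := b.sum_coord_apply_eq_one _
  have hce : ∑ i, c i • b i = latticePoint m := b.linear_combination_coord_eq_self _
  have hpos : ∀ i, 0 < 1 - Int.fract (c i) := fun i => sub_pos.2 (Int.fract_lt_one _)
  -- The total weight is an integer because the coordinates `c i` sum to 1.
  have htsum : ∑ i, (1 - Int.fract (c i)) = ((n + ∑ i, ⌊c i⌋ : ℤ) : ℝ) := by
    simp only [Int.fract, Finset.sum_sub_distrib, hcsum]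
    simp
    ring
  have ht0 : (0 : ℝ) < ∑ i, (1 - Int.fract (c i)) :=
    Finset.sum_pos (fun i _ => hpos i) Finset.univ_nonempty
  have ht1 : ∑ i, (1 - Int.fract (c i)) < n + 1 := by
    have : ∑ i, (1 - Int.fract (c i)) < ∑ _i : Fin (n + 1), (1 : ℝ) :=
      Finset.sum_lt_sum (fun j _ => by linarith [Int.fract_nonneg (c j)])
        ⟨i, Finset.mem_univ i, by
          have := lt_of_le_of_ne (Int.fract_nonneg (c i)) (Ne.symm hi)
          linarith⟩
    simpa using this
  have hmem := sum_smul_mem_interior b hP ht0 rfl hpos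
  rw [htsum] at ht0 ht1 hmem
  obtain ⟨t, ht⟩ : ∃ t : ℕ, (n + ∑ i, ⌊c i⌋ : ℤ) = t :=
    Int.eq_ofNat_of_zero_le (by exact_mod_cast ht0.le)
  rw [ht] at ht0 ht1 hmem
  -- Since `1 - fract c = 1 + ⌊c⌋ - c` and `∑ c i • b i` is `m`, the weighted sum is this lattice
  -- point.
  refine notMem_interior_of_lt_codegree (t := t) (by exact_mod_cast ht0)
    (by rw [hcd]; exact_mod_cast ht1) (∑ i, v i + ∑ i, ⌊c i⌋ • v i - m) ?_
  rw [Int.cast_natCast] at hmem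
  convert hmem using 1
  rw [latticePoint_sub, latticePoint_add, latticePoint_sum, latticePoint_sum, ← hce]
  simp only [latticePoint_zsmul, ← hv, Int.fract, sub_smul, one_smul, Finset.sum_sub_distrib]
  abel

/-! ### The edge matrix of a lattice simplex -/

/-- The matrix whose columns are the edges of a simplex at its vertex `v 0`. -/
def edgeMatrix {n : ℕ} (v : Fin (n + 1) → Fin n → ℤ) : Matrix (Fin n) (Fin n) ℤ :=
  Matrix.of fun i j => v j.succ i - v 0 i

lemma edgeMatrix_mulVec {n : ℕ} (v : Fin (n + 1) → Fin n → ℤ) (x : Fin n → ℝ) :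
    ((edgeMatrix v).map (Int.cast : ℤ → ℝ)).mulVec x =
      ∑ j, x j • (latticePoint (v j.succ) - latticePoint (v 0)) := by
  ext i
  simp [edgeMatrix, Matrix.mulVec, dotProduct, latticePoint, Finset.sum_apply, mul_comm]

/-- The integral barycentric coordinates of `v 0 + m`, other than the one at `v 0`, express `m` in
the edges. So the matrix is surjective on `ℤⁿ` and has a right inverse. -/
lemma isUnit_det_edgeMatrix {n : ℕ} (b : AffineBasis (Fin (n + 1)) ℝ (Fin n → ℝ))
    (v : Fin (n + 1) → Fin n → ℤ) (hv : ∀ i, b i = latticePoint (v i))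
    (hint : ∀ m i, Int.fract (b.coord i (latticePoint m)) = 0) :
    IsUnit (edgeMatrix v).det := by
  have key : ∀ m : Fin n → ℤ, ∃ y : Fin n → ℤ, (edgeMatrix v).mulVec y = m := by
    intro m
    refine ⟨fun j => ⌊b.coord j.succ (latticePoint (v 0 + m))⌋, latticePoint_injective ?_⟩
    have hfl : ∀ i, (⌊b.coord i (latticePoint (v 0 + m))⌋ : ℝ) =
        b.coord i (latticePoint (v 0 + m)) := fun i => by
      have h1 := hint (v 0 + m) i
      have h2 := Int.floor_add_fract (b.coord i (latticePoint (v 0 + m)))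
      rw [h1, add_zero] at h2
      exact h2
    have h1 := b.linear_combination_coord_eq_self (latticePoint (v 0 + m))
    have h2 := b.sum_coord_apply_eq_one (latticePoint (v 0 + m))
    rw [Fin.sum_univ_succ] at h1 h2
    rw [latticePoint_mulVec, edgeMatrix_mulVec]
    simp only [smul_sub, Finset.sum_sub_distrib, ← Finset.sum_smul, hv] at h1 ⊢
    have h3 : ∑ j : Fin n, b.coord j.succ (latticePoint (v 0 + m)) =
        1 - b.coord 0 (latticePoint (v 0 + m)) := by linarith
    have h4 : latticePoint (fun j : Fin n => ⌊b.coord j.succ (latticePoint (v 0 + m))⌋) =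
        fun j => b.coord j.succ (latticePoint (v 0 + m)) := funext fun j => hfl j.succ
    rw [h4, h3]
    simp only [latticePoint_add, sub_smul, one_smul] at h1 ⊢
    rw [eq_sub_of_add_eq' h1]
    abel
  choose y hy using key
  have : edgeMatrix v * (Matrix.of fun i j => y (Pi.single j 1) i) = 1 := by
    ext i j
    have := congrFun (hy (Pi.single j 1)) i
    rw [Matrix.mul_apply]
    simpa [Matrix.mulVec, dotProduct, Matrix.one_apply, Pi.single_apply] using this
  exact Matrix.isUnit_det_of_right_inverse this

lemma image_unimodularSimplex {n : ℕ} (v : Fin (n + 1) → Fin n → ℤ) :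
    (fun x => ((edgeMatrix v).map (Int.cast : ℤ → ℝ)).mulVec x + latticePoint (v 0)) ''
      unimodularSimplex n = convexHull ℝ (Set.range fun i => latticePoint (v i)) := by
  let f : (Fin n → ℝ) →ᵃ[ℝ] (Fin n → ℝ) :=
    (Matrix.mulVecLin ((edgeMatrix v).map (Int.cast : ℤ → ℝ))).toAffineMap +
      AffineMap.const ℝ _ (latticePoint (v 0))
  have hf : (fun x => ((edgeMatrix v).map (Int.cast : ℤ → ℝ)).mulVec x + latticePoint (v 0)) = f :=
    rfl
  have h0 : f 0 = latticePoint (v 0) := by simp [f]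
  have hs : ∀ j : Fin n, f (Pi.single j 1) = latticePoint (v j.succ) := fun j => by
    rw [← hf]
    simp only [edgeMatrix_mulVec]
    simp [Pi.single_apply, ite_smul]
  rw [hf, unimodularSimplex, AffineMap.image_convexHull, Set.image_insert_eq, ← Set.range_comp, h0]
  congr 1
  ext x
  simp [Fin.exists_fin_succ, hs, eq_comm]

/-! ### The codegree of the standard simplex and its invariance -/

/-- The standard description of dilates of the unimodular simplex. -/
lemma mem_smul_unimodularSimplex {n t : ℕ} (ht : 0 < t) (x : Fin n → ℝ) :
    x ∈ (t : ℝ) • unimodularSimplex n ↔ (∀ i, 0 ≤ x i) ∧ ∑ i, x i ≤ t := by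
  have ht' : (0 : ℝ) < t := by exact_mod_cast ht
  constructor
  · rintro ⟨y, hy, rfl⟩
    have hsub : unimodularSimplex n ⊆ {y | (∀ i, 0 ≤ y i) ∧ ∑ i, y i ≤ 1} := by
      refine convexHull_min ?_ ?_
      · rintro _ (rfl | ⟨j, rfl⟩)
        · simp
        · refine ⟨fun i => ?_, by simp⟩
          simp only
          rw [Pi.single_apply]
          split_ifs <;> norm_num
      · rintro a ⟨ha, ha'⟩ c ⟨hc, hc'⟩ p q hp hq hpq
        refine ⟨fun i => ?_, ?_⟩
        · have := ha i
          have := hc i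
          simp only [Pi.add_apply, Pi.smul_apply, smul_eq_mul]
          positivity
        · simp only [Pi.add_apply, Pi.smul_apply, smul_eq_mul, Finset.sum_add_distrib,
            ← Finset.mul_sum]
          nlinarith
    obtain ⟨h1, h2⟩ := hsub hy
    refine ⟨fun i => mul_nonneg ht'.le (h1 i), ?_⟩
    simp only [Pi.smul_apply, smul_eq_mul, ← Finset.mul_sum]
    nlinarith
  · rintro ⟨h1, h2⟩
    refine ⟨(t : ℝ)⁻¹ • x, ?_, smul_inv_smul₀ ht'.ne' x⟩
    have hle : ∑ i, (t : ℝ)⁻¹ * x i ≤ 1 := by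
      rw [← Finset.mul_sum, inv_mul_le_iff₀ ht', mul_one]
      exact h2
    have := (convex_convexHull ℝ (insert 0 (Set.range fun i : Fin n => Pi.single i (1 : ℝ)))).sum_mem
      (t := Finset.univ) (w := fun o : Option (Fin n) =>
        o.elim (1 - ∑ i, (t : ℝ)⁻¹ * x i) fun i => (t : ℝ)⁻¹ * x i)
      (z := fun o : Option (Fin n) => o.elim 0 fun i => Pi.single i (1 : ℝ))
      (by
        rintro (_ | i) -
        · simpa using hle
        · have := h1 i
          simp only [Option.elim]
          positivity)
      (by simp [Fintype.sum_option])
      (by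
        rintro (_ | i) -
        · exact subset_convexHull ℝ _ (Set.mem_insert _ _)
        · exact subset_convexHull ℝ _ (Set.mem_insert_of_mem _ ⟨i, rfl⟩))
    rw [unimodularSimplex]
    convert this using 1
    ext j
    simp [Fintype.sum_option, Finset.sum_apply, Pi.single_apply]

lemma smul_image_affine {n : ℕ} (A : Matrix (Fin n) (Fin n) ℝ) (b : Fin n → ℝ) (t : ℝ)
    (Q : Set (Fin n → ℝ)) :
    t • ((fun x => A.mulVec x + b) '' Q) = (fun x => A.mulVec x + t • b) '' (t • Q) := by
  ext y
  simp [Set.mem_smul_set, Matrix.mulVec_smul]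

/-- Lattice points interior to dilates of the unimodular simplex. -/
lemma latticePoint_mem_interior_smul_unimodularSimplex {n t : ℕ} (ht : 0 < t) (m : Fin n → ℤ) :
    latticePoint m ∈ interior ((t : ℝ) • unimodularSimplex n) ↔ (∀ i, 0 < m i) ∧ ∑ i, m i < t := by
  constructor
  · intro h
    -- Moving along `(1, …, 1)` both ways makes all the inequalities strict: backwards for the
    -- coordinates, forwards for their sum.
    have hcont : Continuous fun s : ℝ => latticePoint m + s • (1 : Fin n → ℝ) := by fun_prop
    have hev : ∀ᶠ s in nhds (0 : ℝ), latticePoint m + s • (1 : Fin n → ℝ) ∈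
        (t : ℝ) • unimodularSimplex n := by
      refine hcont.continuousAt.eventually (f := fun s : ℝ => latticePoint m + s • (1 : Fin n → ℝ)) ?_
      simpa using mem_interior_iff_mem_nhds.1 h
    obtain ⟨ε, hε, hball⟩ := Metric.eventually_nhds_iff.1 hev
    have hp := (mem_smul_unimodularSimplex ht _).1
      (hball (y := ε / 2) (by rw [Real.dist_0_eq_abs, abs_of_pos (by positivity)]; linarith))
    have hn := (mem_smul_unimodularSimplex ht _).1
      (hball (y := -(ε / 2)) (by
        rw [Real.dist_0_eq_abs, abs_neg, abs_of_pos (by positivity)]; linarith))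
    refine ⟨fun i => ?_, ?_⟩
    · have := hn.1 i
      simp [latticePoint] at this
      have : (0 : ℝ) < m i := by linarith
      exact_mod_cast this
    · have h2 := hp.2
      -- For `n = 0` the displacement does not change the sum, which is empty.
      rcases Nat.eq_zero_or_pos n with rfl | hn0
      · simpa using ht
      · have hn0' : (0 : ℝ) < n := by exact_mod_cast hn0
        simp [latticePoint, Finset.sum_add_distrib] at h2
        have : ((∑ i, m i : ℤ) : ℝ) < t := by
          push_cast
          nlinarith [mul_pos hn0' hε]
        exact_mod_cast this
  · rintro ⟨h1, h2⟩
    refine interior_maximal (s := (t : ℝ) • unimodularSimplex n)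
      (t := {x | (∀ i, 0 < x i) ∧ ∑ i, x i < t}) ?_ ?_ ⟨fun i => ?_, ?_⟩
    · exact fun x hx => (mem_smul_unimodularSimplex ht x).2 ⟨fun i => (hx.1 i).le, hx.2.le⟩
    · refine IsOpen.inter (s := {x : Fin n → ℝ | ∀ i, 0 < x i}) ?_ (isOpen_lt
        (continuous_finsetSum _ fun i _ => continuous_apply i) continuous_const)
      have : IsOpen (⋂ i, {x : Fin n → ℝ | 0 < x i}) :=
        isOpen_iInter_of_finite fun i => isOpen_lt continuous_const (continuous_apply i)
      convert this using 1
      ext x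
      simp only [Set.mem_iInter]
      rfl
    · simpa [latticePoint] using h1 i
    · simp only [latticePoint]
      exact_mod_cast h2

lemma codegree_of_unimodularlyEquivalent {n : ℕ} {P Q : Set (Fin n → ℝ)}
    (h : UnimodularlyEquivalent P Q) : codegree P = codegree Q := by
  obtain ⟨A, b, hA, rfl⟩ := h
  set R : Matrix (Fin n) (Fin n) ℝ := A.map (Int.cast : ℤ → ℝ) with hR
  set C : Matrix (Fin n) (Fin n) ℝ := A⁻¹.map (Int.cast : ℤ → ℝ) with hC
  have hRC : R * C = 1 := by
    have := congrArg (fun M => M.map (Int.castRingHom ℝ)) (Matrix.mul_nonsing_inv A hA)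
    simp only [Matrix.map_mul] at this
    simpa using this
  have hCR : C * R = 1 := mul_eq_one_comm.1 hRC
  have hmem : ∀ t : ℕ, (∃ m, latticePoint m ∈ interior ((t : ℝ) •
      ((fun x => R.mulVec x + latticePoint b) '' Q))) ↔
      ∃ m, latticePoint m ∈ interior ((t : ℝ) • Q) := by
    intro t
    let f : (Fin n → ℝ) ≃ₜ (Fin n → ℝ) :=
      { toFun := fun x => R.mulVec x + (t : ℝ) • latticePoint b
        invFun := fun x => C.mulVec (x - (t : ℝ) • latticePoint b)
        left_inv := fun x => by simp [Matrix.mulVec_mulVec, hCR]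
        right_inv := fun x => by simp [Matrix.mulVec_mulVec, hRC]
        continuous_toFun := by fun_prop
        continuous_invFun := by fun_prop }
    have hf : (t : ℝ) • ((fun x => R.mulVec x + latticePoint b) '' Q) = f '' ((t : ℝ) • Q) :=
      smul_image_affine _ _ _ _
    rw [hf, ← f.image_interior]
    constructor
    · rintro ⟨m, x, hx, hxm⟩
      -- Dilation by `t` turns the translation into `t • b`, still a lattice vector as `t` is an
      -- integer.
      refine ⟨A⁻¹.mulVec (m - (t : ℤ) • b), ?_⟩
      have : x = f.symm (latticePoint m) := by rw [← hxm, f.symm_apply_apply]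
      rw [this] at hx
      convert hx using 1
      rw [latticePoint_mulVec, latticePoint_sub, latticePoint_zsmul, Int.cast_natCast]
      rfl
    · rintro ⟨m, hm⟩
      refine ⟨A.mulVec m + (t : ℤ) • b, latticePoint m, hm, ?_⟩
      rw [latticePoint_add, latticePoint_mulVec, latticePoint_zsmul, Int.cast_natCast]
      rfl
  simp only [codegree, hmem]

lemma codegree_unimodularSimplex (n : ℕ) : codegree (unimodularSimplex n) = n + 1 := by
  have hmem : ∀ t : ℕ, (0 < t ∧ ∃ m : Fin n → ℤ,
      latticePoint m ∈ interior ((t : ℝ) • unimodularSimplex n)) ↔ n + 1 ≤ t := by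
    intro t
    constructor
    · rintro ⟨ht, m, hm⟩
      rw [latticePoint_mem_interior_smul_unimodularSimplex ht] at hm
      have : ∑ _i : Fin n, (1 : ℤ) ≤ ∑ i, m i := Finset.sum_le_sum fun i _ => hm.1 i
      simp at this
      have := hm.2
      omega
    · intro ht
      refine ⟨by omega, 1, ?_⟩
      rw [latticePoint_mem_interior_smul_unimodularSimplex (by omega)]
      simp
      omega
  simp only [codegree, hmem]
  exact csInf_Ici

/-! ### A lattice simplex inside the polytope, and the theorem -/

lemma exists_affineBasis_latticePoint {n : ℕ} {S : Set (Fin n → ℤ)}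
    (h : affineSpan ℝ (latticePoint '' S) = ⊤) :
    ∃ (b : AffineBasis (Fin (n + 1)) ℝ (Fin n → ℝ)) (v : Fin (n + 1) → Fin n → ℤ),
      (∀ i, b i = latticePoint (v i)) ∧ ∀ i, v i ∈ S := by
  obtain ⟨s, hs, b, hb⟩ := AffineBasis.exists_affine_subbasis h
  have : Finite s := b.finite
  have := Fintype.ofFinite s
  have hcard : Fintype.card s = n + 1 := by simpa using b.card_eq_finrank_add_one
  let e : s ≃ Fin (n + 1) := Fintype.equivFinOfCardEq hcard
  choose v hv hv' using fun i => hs (e.symm i).2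
  exact ⟨b.reindex e, v, fun i => by simp [hb, hv'], hv⟩

end LatticePolytope

theorem mainTheorem7 (n : ℕ) (P : Set (Fin n → ℝ))
    (hP : LatticePolytope.IsLatticePolytope P)
    (hdim : affineSpan ℝ P = ⊤)
    (hG : LatticePolytope.IsGorenstein P) :
    LatticePolytope.codegree P = n + 1 ↔
      LatticePolytope.UnimodularlyEquivalent P (LatticePolytope.unimodularSimplex n) := by
  open LatticePolytope in
  constructor
  · intro hcd
    obtain ⟨S, -, hS⟩ := hP
    rw [hS, affineSpan_convexHull] at hdim
    obtain ⟨b, v, hv, hvS⟩ := exists_affineBasis_latticePoint hdim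
    have hsub : convexHull ℝ (Set.range b) ⊆ P := by
      rw [hS]
      refine convexHull_mono ?_
      rintro _ ⟨i, rfl⟩
      exact ⟨v i, hvS i, (hv i).symm⟩
    have hconv : Convex ℝ P := hS ▸ convex_convexHull ℝ _
    refine ⟨edgeMatrix v, v 0, isUnit_det_edgeMatrix b v hv
      (fract_coord_eq_zero hcd b v hv hsub), ?_⟩
    rw [image_unimodularSimplex, eq_convexHull_of_codegree hconv hcd b v hv hsub]
    simp only [← hv]
  · intro h
    rw [codegree_of_unimodularlyEquivalent h, codegree_unimodularSimplex]
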